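/- Let $A$ be a bounded band operator on $\ell^2(\mathbb Z)$ (its matrix $(A_{i,j})_{i,j\in\mathbb Z}$ is supported on finitely many diagonals), and let $A^*$ be its Banach space adjoint, i.e. the bounded operator on $\ell^2(\mathbb Z)$ whose matrix is the transpose of that of $A$. For $\varepsilon>0$ let $$\operatorname{spec}_\varepsilon A=\{\lambda\in\mathbb C:\|(A-\lambda I)^{-1}\|>1/\varepsilon\},$$ where $\|(A-\lambda I)^{-1}\|:=\infty$ if $A-\lambda I$ is not invertible. Let $d\ge 1$ be such that the matrix of $A$ is block tridiagonal with respect to the partition of $\mathbb Z$ into the blocks $\{dm,\dots,dm+d-1\}$, $m\in\mathbb Z$ (if $A$ has bandwidth $b$, then $d=b+1$ is possible; if $A$ is tridiagonal, then $d=1$ is possible). Let $\alpha=(\alpha_m)_{m\in\mathbb Z}$ and $\gamma=(\gamma_m)_{m\in\mathbb Z}$ be the block subdiagonal and block superdiagonal of $A$, so that $\alpha_m$ is the $d\times d$ block in block row $m+1$ and block column $m$, and $\gamma_m$ the one in block row $m-1$ and block column $m$. With $\|\cdot\|_\infty$ the supremum of the spectral norms of the blocks, put $$\varepsilon_n=2\,(\|\alpha\|_\infty+\|\gamma\|_\infty)\,\sin\frac{\pi}{2(n+1)},\qquad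 n\in\mathbb N.$$ For $n\in\mathbb N$ and $k\in\mathbb Z$ let $S_{n,k}\subset\mathbb Z$ be the union of the blocks number $k+1,\dots,k+n$. For $B\in\{A,A^*\}$ let $BP_{n,k}$ be the restriction of $B$ to the subspace $\ell^2(S_{n,k})$ of the sequences in $\ell^2(\mathbb Z)$ that are supported in $S_{n,k}$ (that is, the matrix of the columns of $B$ with index in $S_{n,k}$), put $$\operatorname{spec}_\varepsilon (BP_{n,k})=\Big\{\lambda\in\mathbb C:\inf\{\|(B-\lambda I)x\|:x\in\ell^2(S_{n,k}),\ \|x\|=1\}<\varepsilon\Big\},$$ and let $\operatorname{spec}_\varepsilon(AP_{n,k},A^*P_{n,k})=\operatorname{spec}_\varepsilon(AP_{n,k})\cup\operatorname{spec}_\varepsilon(A^*P_{n,k})$. Then, for every fixed $\varepsilon>0$, both $$\bigcup_{k\in\mathbb Z}\operatorname{spec}_{\varepsilon}(AP_{n,k},A^*P_{n,k})\qquad\text{and}\qquad \bigcup_{k\in\mathbb Z}\operatorname{spec}_{\varepsilon+\varepsilon_n}(AP_{n,k},A^*P_{n,k})$$ converge to $\operatorname{spec}_\varepsilon A$ in the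 Hausdorff distance as $n\to\infty$. The same holds (with the same $\varepsilon_n$) if, instead, $S_{n,k}=\{k+1,\dots,k+n\}$. -/

import Mathlib

noncomputable section

/-- The Hilbert space `ℓ²(ℤ)` of square-summable bi-infinite complex sequences. -/
abbrev L2Z : Type := lp (fun _ : ℤ => ℂ) 2

/-- The matrix entry `A_{i,j}` (row `i`, column `j`) of a bounded operator on `ℓ²(ℤ)`. -/
def matrixEntry (A : L2Z →L[ℂ] L2Z) (i j : ℤ) : ℂ :=
  A (lp.single 2 j (1 : ℂ)) i

/-- `A` is a band operator: its matrix is supported on finitely many diagonals. -/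
def IsBandOperator (A : L2Z →L[ℂ] L2Z) : Prop :=
  ∃ b : ℕ, ∀ i j : ℤ, (b : ℤ) < |i - j| → matrixEntry A i j = 0

/-- `A` is block tridiagonal with respect to the partition of `ℤ` into the blocks
`{d * m, …, d * m + d - 1}`, `m ∈ ℤ`, of length `d` (so `i` lies in block number `⌊i / d⌋`).
For `d = 1` this means tridiagonal. -/
def IsBlockTridiagonal (d : ℕ) (A : L2Z →L[ℂ] L2Z) : Prop :=
  ∀ i j : ℤ, 1 < |i / (d : ℤ) - j / (d : ℤ)| → matrixEntry A i j = 0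

/-- A matrix of bandwidth at most `b` is block tridiagonal for every block length `d ≥ max 1 b`,
in particular for `d = b + 1`. -/
theorem isBlockTridiagonal_of_bandwidth (A : L2Z →L[ℂ] L2Z) (b d : ℕ) (hd : 0 < d) (hbd : b ≤ d)
    (hA : ∀ i j : ℤ, (b : ℤ) < |i - j| → matrixEntry A i j = 0) : IsBlockTridiagonal d A := by
  intro i j hij
  apply hA
  have hd' : (0 : ℤ) < d := by exact_mod_cast hd
  have hbd' : (b : ℤ) ≤ d := by exact_mod_cast hbd
  have h1 := Int.mul_ediv_add_emod i d
  have h2 := Int.mul_ediv_add_emod j d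
  have h3 := Int.emod_nonneg i hd'.ne'
  have h4 := Int.emod_nonneg j hd'.ne'
  have h5 := Int.emod_lt_of_pos i hd'
  have h6 := Int.emod_lt_of_pos j hd'
  rcases lt_abs.1 hij with h | h
  · apply lt_abs.2
    left
    nlinarith
  · apply lt_abs.2
    right
    nlinarith

/-- The block in block row `p` and block column `q` of `A`, for blocks of length `d`. -/
def matrixBlock (d : ℕ) (A : L2Z →L[ℂ] L2Z) (p q : ℤ) : Matrix (Fin d) (Fin d) ℂ :=
  Matrix.of fun i j => matrixEntry A ((d : ℤ) * p + (i : ℤ)) ((d : ℤ) * q + (j : ℤ))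

/-- The norm of that block as an operator on the Euclidean space `ℂ^d`. -/
def blockNorm (d : ℕ) (A : L2Z →L[ℂ] L2Z) (p q : ℤ) : ℝ :=
  ‖Matrix.toEuclideanCLM (n := Fin d) (𝕜 := ℂ) (matrixBlock d A p q)‖

/-- `ε_n = 2 (‖α‖_∞ + ‖γ‖_∞) sin (π / (2 (n + 1)))`, where `α_m = A_{m+1,m}` and `γ_m = A_{m-1,m}`
are the sub- and superdiagonal of the block matrix of `A` with blocks of length `d`. -/
def epsSeq (d : ℕ) (A : L2Z →L[ℂ] L2Z) (n : ℕ) : ℝ :=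
  2 * ((⨆ m : ℤ, blockNorm d A (m + 1) m) + ⨆ m : ℤ, blockNorm d A (m - 1) m) *
    Real.sin (Real.pi / (2 * ((n : ℝ) + 1)))

/-- The Banach space adjoint of `A`, with the dual of `ℓ²(ℤ)` identified with `ℓ²(ℤ)` through the
bilinear pairing `(x, y) ↦ ∑ x_i y_i`. It is obtained from the Hilbert space adjoint by complex
conjugation on both sides; its matrix is the transpose of that of `A`. -/
def banachAdjoint (A : L2Z →L[ℂ] L2Z) : L2Z →L[ℂ] L2Z :=
  ((starₗᵢ ℂ : L2Z ≃ₗᵢ⋆[ℂ] L2Z) : L2Z →L⋆[ℂ] L2Z).comp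
    ((ContinuousLinearMap.adjoint A).comp
      ((starₗᵢ ℂ : L2Z ≃ₗᵢ⋆[ℂ] L2Z) : L2Z →L⋆[ℂ] L2Z))

theorem banachAdjoint_apply (A : L2Z →L[ℂ] L2Z) (x : L2Z) :
    banachAdjoint A x = star (ContinuousLinearMap.adjoint A (star x)) := rfl

/-- The defining property of the Banach space adjoint. -/
theorem tsum_mul_banachAdjoint (A : L2Z →L[ℂ] L2Z) (x y : L2Z) :
    ∑' i : ℤ, x i * banachAdjoint A y i = ∑' i : ℤ, A x i * y i := by
  have h := ContinuousLinearMap.adjoint_inner_left A x (star y)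
  rw [lp.inner_eq_tsum, lp.inner_eq_tsum] at h
  simpa [banachAdjoint_apply, mul_comm] using h

/-- The lower norm `ν(T) = inf {‖T x‖ : ‖x‖ = 1}`. -/
def lowerNorm {E F : Type*} [NormedAddCommGroup E] [NormedSpace ℂ E] [NormedAddCommGroup F]
    [NormedSpace ℂ F] (T : E →L[ℂ] F) : ℝ :=
  sInf {r : ℝ | ∃ x : E, ‖x‖ = 1 ∧ r = ‖T x‖}

/-- The subspace `ℓ²(S)` of the sequences in `ℓ²(ℤ)` that are supported in `S`. -/
def l2On (S : Set ℤ) : Submodule ℂ L2Z where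
  carrier := {x | ∀ i, i ∉ S → x i = 0}
  zero_mem' := fun _ _ => rfl
  add_mem' := by
    intro x y hx hy i hi
    simp [hx i hi, hy i hi]
  smul_mem' := by
    intro c x hx i hi
    simp [hx i hi]

/-- The restriction `A|_{ℓ²(S)} : ℓ²(S) → ℓ²(ℤ)`, that is, the columns of `A` with index in `S`. -/
def restrictCols (A : L2Z →L[ℂ] L2Z) (S : Set ℤ) : l2On S →L[ℂ] L2Z :=
  A.comp (l2On S).subtypeL

/-- The (open) pseudospectrum `spec_ε A = {λ : ‖(A - λ I)⁻¹‖ > 1 / ε}`, with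
`‖(A - λ I)⁻¹‖ = ∞` when `A - λ I` is not invertible. -/
def pseudospectrum (ε : ℝ) (A : L2Z →L[ℂ] L2Z) : Set ℂ :=
  {z | ¬ IsUnit (A - z • (1 : L2Z →L[ℂ] L2Z)) ∨
    1 / ε < ‖Ring.inverse (A - z • (1 : L2Z →L[ℂ] L2Z))‖}

/-- The pseudospectrum of the rectangular matrix of the columns of `A` with index in `S`:
the set of the `λ` with `ν((A - λ I)|_{ℓ²(S)}) < ε`. -/
def pseudospectrumCols (ε : ℝ) (A : L2Z →L[ℂ] L2Z) (S : Set ℤ) : Set ℂ :=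
  {z | lowerNorm (restrictCols (A - z • (1 : L2Z →L[ℂ] L2Z)) S) < ε}

/-- The set of all indices in the blocks number `k + 1, …, k + n` of length `s`.
For `s = 1` it is `{k + 1, …, k + n}`. -/
def window (s n : ℕ) (k : ℤ) : Set ℤ :=
  {i | k + 1 ≤ i / (s : ℤ) ∧ i / (s : ℤ) ≤ k + n}

/-- `⋃_{k ∈ ℤ} spec_ε (A P_{n,k}, A^* P_{n,k})`, where `P_{n,k}` is the projection onto the blocks
number `k + 1, …, k + n` of length `s`. -/
def inclusionSet (s n : ℕ) (ε : ℝ) (A : L2Z →L[ℂ] L2Z) : Set ℂ :=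
  ⋃ k : ℤ, pseudospectrumCols ε A (window s n k) ∪
    pseudospectrumCols ε (banachAdjoint A) (window s n k)

end

open Filter Topology


/-! Write "spec" for `pseudospectrum`. A point lies in spec_ε iff A - z or its transpose shrinks
some vector by a factor below ε; the inclusion sets ask the same of vectors supported in a window.
So they lie in the pseudospectrum with the same parameter, and truncating a test vector puts each
point of spec_ε into all late inclusion sets (`eventually_mem_inclusionSet`). Total boundedness
makes this uniform up to δ.

What remains is that spec_{ε+η} lies near spec_ε for small η
(`eventually_exists_mem_pseudospectrum_dist_lt`), which fails if the resolvent norm is constant on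
an open set. In a Hilbert space this is impossible: if ‖R‖ ≤ M on a disc about c, averaging with a
nonnegative kernel bounds ‖R(c) ± (r/2) R'(c)‖ by M, and the parallelogram law with R' = R² makes
‖R(c)‖ smaller than M by a definite amount. -/

/-! ### A Cauchy estimate for vector-valued holomorphic functions -/

/-- Cauchy's formula for `z ↦ (r + σ (z - c))² • f z` averages `f` against a nonnegative kernel. -/
theorem norm_smul_add_smul_deriv_le {E : Type*} [NormedAddCommGroup E] [NormedSpace ℂ E]
    [CompleteSpace E] {f : ℂ → E} {U : Set ℂ} (hU : IsOpen U) {c : ℂ} {r M σ : ℝ} (hr : 0 < r)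
    (hσ : σ ^ 2 = 1) (hc : Metric.closedBall c r ⊆ U) (hf : DifferentiableOn ℂ f U)
    (hM : ∀ z ∈ Metric.closedBall c r, ‖f z‖ ≤ M) :
    ‖f c + ((σ * (r / 2) : ℝ) : ℂ) • deriv f c‖ ≤ M := by
  have hcU : c ∈ U := hc (Metric.mem_closedBall_self hr.le)
  have hfd : HasDerivAt f (deriv f c) c :=
    ((hf c hcU).differentiableAt (hU.mem_nhds hcU)).hasDerivAt
  have hσC : (σ : ℂ) ^ 2 = 1 := by exact_mod_cast hσ
  have hp : HasDerivAt (fun z : ℂ => ((r : ℂ) + σ * (z - c)) ^ 2) (2 * r * σ) c :=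
    HasDerivAt.congr_deriv (((((hasDerivAt_id c).sub_const c).const_mul (σ : ℂ)).const_add
      (r : ℂ)).pow 2) (by simp)
  -- The product rule gives 2rσ f + r² f'; since σ² = 1, the factor 2rσ can be pulled out.
  have hg : HasDerivAt (fun z : ℂ => ((r : ℂ) + σ * (z - c)) ^ 2 • f z)
      ((2 * r * σ : ℂ) • (f c + ((σ * (r / 2) : ℝ) : ℂ) • deriv f c)) c := by
    refine HasDerivAt.congr_deriv (hp.smul hfd) ?_
    simp only [sub_self, mul_zero, add_zero, smul_add, smul_smul]
    rw [add_comm]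
    congr 2
    push_cast
    linear_combination (-(r : ℂ) ^ 2) * hσC
  have hgd : DifferentiableOn ℂ (fun z : ℂ => ((r : ℂ) + σ * (z - c)) ^ 2 • f z) U :=
    DifferentiableOn.smul (by fun_prop) hf
  have hcauchy := Complex.two_pi_I_inv_smul_circleIntegral_sub_sq_inv_smul_of_differentiable hU hc
    hgd (Metric.mem_ball_self hr)
  rw [hg.deriv] at hcauchy
  have hbound : ‖∮ z in C(c, r), ((z - c) ^ 2)⁻¹ • ((r : ℂ) + σ * (z - c)) ^ 2 • f z‖
      ≤ ∫ θ in (0 : ℝ)..2 * Real.pi, 2 * r * M * (1 + σ * Real.cos θ) := by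
    rw [circleIntegral]
    refine intervalIntegral.norm_integral_le_of_norm_le (by positivity)
      (Filter.Eventually.of_forall fun θ _ => ?_)
      (Continuous.intervalIntegrable (by fun_prop) _ _)
    have hz : ‖circleMap c r θ - c‖ = r := by simp [circleMap, abs_of_pos hr]
    -- On the circle the squared weight divided by |z - c|² is 2(1 + σ cos θ) in modulus; the cosine
    -- then integrates to zero.
    have hk : ‖(r : ℂ) + σ * (circleMap c r θ - c)‖ ^ 2 = 2 * r ^ 2 * (1 + σ * Real.cos θ) := by
      have : (r : ℂ) + σ * (circleMap c r θ - c)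
          = (⟨r + σ * (r * Real.cos θ), σ * (r * Real.sin θ)⟩ : ℂ) := by
        apply Complex.ext <;> simp [circleMap, Complex.exp_re, Complex.exp_im]
      rw [this, ← Complex.normSq_eq_norm_sq, Complex.normSq_mk]
      linear_combination (r ^ 2 * Real.cos θ ^ 2 + r ^ 2 * Real.sin θ ^ 2) * hσ
        + r ^ 2 * Real.sin_sq_add_cos_sq θ
    have hMθ := hM (circleMap c r θ) (circleMap_mem_closedBall c hr.le θ)
    rw [norm_smul, norm_smul, norm_smul, norm_inv, norm_pow, norm_pow, hz, hk, deriv_circleMap]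
    have h1 : ‖circleMap 0 r θ * Complex.I‖ = r := by simp [abs_of_pos hr]
    rw [h1]
    have h2 : 0 ≤ 2 * r ^ 2 * (1 + σ * Real.cos θ) := hk ▸ by positivity
    have h3 : 0 ≤ 1 + σ * Real.cos θ := by
      by_contra! h
      nlinarith [pow_pos hr 2]
    calc r * ((r ^ 2)⁻¹ * (2 * r ^ 2 * (1 + σ * Real.cos θ) * ‖f (circleMap c r θ)‖))
        = 2 * r * (1 + σ * Real.cos θ) * ‖f (circleMap c r θ)‖ := by field_simp
      _ ≤ 2 * r * (1 + σ * Real.cos θ) * M := by gcongr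
      _ = _ := by ring
  have hint : ∫ θ in (0 : ℝ)..2 * Real.pi, 2 * r * M * (1 + σ * Real.cos θ)
      = 2 * r * M * (2 * Real.pi) := by
    rw [intervalIntegral.integral_const_mul, intervalIntegral.integral_add (by simp)
      (Continuous.intervalIntegrable (by fun_prop) _ _), intervalIntegral.integral_const_mul,
      integral_cos]
    simp
  rw [hint] at hbound
  have hn := congrArg norm hcauchy
  have hσn : |σ| = 1 := by
    rw [← sq_eq_sq₀ (abs_nonneg σ) zero_le_one, sq_abs, hσ, one_pow]
  rw [norm_smul, norm_smul] at hn
  have e1 : ‖(2 * (Real.pi : ℂ) * Complex.I)⁻¹‖ = (2 * Real.pi)⁻¹ := by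
    simp [abs_of_pos Real.pi_pos]
  have e2 : ‖(2 * r * σ : ℂ)‖ = 2 * r := by simp [hσn, abs_of_pos hr]
  rw [e1, e2] at hn
  have h4 : 2 * r * ‖f c + ((σ * (r / 2) : ℝ) : ℂ) • deriv f c‖ ≤ 2 * r * M := by
    rw [← hn]
    calc _ ≤ (2 * Real.pi)⁻¹ * (2 * r * M * (2 * Real.pi)) := by gcongr
      _ = _ := by have := Real.pi_pos; field_simp
  exact le_of_mul_le_mul_left h4 (by positivity)

/-! ### Invertibility, lower bounds and the resolvent -/

theorem inverse_apply_apply {H : Type*} [NormedAddCommGroup H] [NormedSpace ℂ H]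
    {T : H →L[ℂ] H} (hT : IsUnit T) (x : H) :
    Ring.inverse T (T x) = x := by
  simpa using DFunLike.congr_fun (Ring.inverse_mul_cancel T hT) x

theorem apply_inverse_apply {H : Type*} [NormedAddCommGroup H] [NormedSpace ℂ H]
    {T : H →L[ℂ] H} (hT : IsUnit T) (x : H) :
    T (Ring.inverse T x) = x := by
  simpa using DFunLike.congr_fun (Ring.mul_inverse_cancel T hT) x

theorem le_norm_apply_of_norm_inverse_le {H : Type*} [NormedAddCommGroup H]
    [NormedSpace ℂ H] {T : H →L[ℂ] H} (hT : IsUnit T) {ε : ℝ} (hε : 0 < ε)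
    (h : ‖Ring.inverse T‖ ≤ 1 / ε) (x : H) : ε * ‖x‖ ≤ ‖T x‖ := by
  have h1 : ‖x‖ ≤ 1 / ε * ‖T x‖ := by
    calc ‖x‖ = ‖Ring.inverse T (T x)‖ := by rw [inverse_apply_apply hT]
      _ ≤ _ := (Ring.inverse T).le_of_opNorm_le h _
  rwa [one_div, inv_mul_eq_div, le_div_iff₀ hε, mul_comm] at h1

section Operators

variable {H : Type*} [NormedAddCommGroup H] [InnerProductSpace ℂ H] [CompleteSpace H]

/-- The lower bound on T gives injectivity and closed range; the one on the adjoint kills the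
orthogonal complement of the range. -/
theorem isUnit_of_antilipschitz_of_adjoint (T : H →L[ℂ] H) {ε : ℝ} (hε : 0 < ε)
    (h1 : ∀ x, ε * ‖x‖ ≤ ‖T x‖) (h2 : ∀ x, ε * ‖x‖ ≤ ‖ContinuousLinearMap.adjoint T x‖) :
    IsUnit T := by
  rw [ContinuousLinearMap.isUnit_iff_bijective,
    ContinuousLinearMap.bijective_iff_dense_range_and_antilipschitz]
  constructor
  · rw [Submodule.topologicalClosure_eq_top_iff, ContinuousLinearMap.orthogonal_range,
      LinearMap.ker_eq_bot']
    intro x hx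
    have := h2 x
    have hx' : ContinuousLinearMap.adjoint T x = 0 := hx
    rw [hx', norm_zero] at this
    exact norm_le_zero_iff.1 (by nlinarith)
  · refine ⟨⟨ε⁻¹, by positivity⟩, AddMonoidHomClass.antilipschitz_of_bound T fun x => ?_⟩
    change ‖x‖ ≤ ε⁻¹ * ‖T x‖
    rw [inv_mul_eq_div, le_div_iff₀ hε, mul_comm]
    exact h1 x

theorem not_isUnit_or_lt_norm_inverse_iff (T : H →L[ℂ] H) {ε : ℝ} (hε : 0 < ε) :
    (¬ IsUnit T ∨ 1 / ε < ‖Ring.inverse T‖) ↔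
      (∃ x, ‖T x‖ < ε * ‖x‖) ∨ ∃ x, ‖ContinuousLinearMap.adjoint T x‖ < ε * ‖x‖ := by
  constructor
  · contrapose!
    rintro ⟨h1, h2⟩
    have hT := isUnit_of_antilipschitz_of_adjoint T hε h1 h2
    refine ⟨hT, ContinuousLinearMap.opNorm_le_bound _ (by positivity) fun y => ?_⟩
    have := h1 (Ring.inverse T y)
    rw [apply_inverse_apply hT] at this
    rwa [one_div, inv_mul_eq_div, le_div_iff₀ hε, mul_comm]
  · contrapose!
    rintro ⟨hT, h⟩
    refine ⟨le_norm_apply_of_norm_inverse_le hT hε h, ?_⟩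
    rw [← ContinuousLinearMap.star_eq_adjoint]
    refine le_norm_apply_of_norm_inverse_le hT.star hε ?_
    rwa [Ring.inverse_star, norm_star]

theorem hasDerivAt_inverse_sub_smul_one (A : H →L[ℂ] H) {z : ℂ}
    (hz : IsUnit (A - z • (1 : H →L[ℂ] H))) :
    HasDerivAt (fun w : ℂ => Ring.inverse (A - w • (1 : H →L[ℂ] H)))
      (Ring.inverse (A - z • (1 : H →L[ℂ] H)) ^ 2) z := by
  have h1 : HasFDerivAt Ring.inverse _ (A - z • (1 : H →L[ℂ] H)) :=
    hasFDerivAt_ringInverse (𝕜 := ℂ) hz.unit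
  have h2 : HasDerivAt (fun w : ℂ => A - w • (1 : H →L[ℂ] H)) (-1) z := by
    refine HasDerivAt.congr_deriv (((hasDerivAt_id z).smul_const (1 : H →L[ℂ] H)).const_sub A) ?_
    simp
  simpa [sq, hz.unit_spec, ← Ring.inverse_unit hz.unit] using! h1.comp_hasDerivAt z h2

/-- A quantitative form of the fact that the resolvent norm of a Hilbert space operator has no
local maximum. -/
theorem norm_inverse_sq_le_of_forall_ball (A : H →L[ℂ] H) {c : ℂ} {r M : ℝ}
    (hr : 0 < r) (hball : ∀ z ∈ Metric.ball c (2 * r), IsUnit (A - z • (1 : H →L[ℂ] H)) ∧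
      ‖Ring.inverse (A - z • (1 : H →L[ℂ] H))‖ ≤ M) (x : H) :
    ‖Ring.inverse (A - c • (1 : H →L[ℂ] H)) x‖ ^ 2 +
      (r / 2) ^ 2 * ‖(Ring.inverse (A - c • (1 : H →L[ℂ] H)) ^ 2) x‖ ^ 2 ≤ M ^ 2 * ‖x‖ ^ 2 := by
  set f : ℂ → H →L[ℂ] H := fun w => Ring.inverse (A - w • (1 : H →L[ℂ] H)) with hfdef
  have hsub : Metric.closedBall c r ⊆ Metric.ball c (2 * r) :=
    Metric.closedBall_subset_ball (by linarith)
  have hder : deriv f c = f c ^ 2 :=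
    (hasDerivAt_inverse_sub_smul_one A (hball c (Metric.mem_ball_self (by linarith))).1).deriv
  have key : ∀ σ : ℝ, σ ^ 2 = 1 → ‖f c + ((σ * (r / 2) : ℝ) : ℂ) • f c ^ 2‖ ≤ M := fun σ hσ => by
    rw [← hder]
    exact norm_smul_add_smul_deriv_le Metric.isOpen_ball hr hσ hsub
      (fun z hz => (hasDerivAt_inverse_sub_smul_one A
        (hball z hz).1).differentiableAt.differentiableWithinAt)
      (fun z hz => (hball z (hsub hz)).2)
  have h1 := (f c + ((1 * (r / 2) : ℝ) : ℂ) • f c ^ 2).le_of_opNorm_le (key 1 (by norm_num)) x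
  have h2 := (f c + ((-1 * (r / 2) : ℝ) : ℂ) • f c ^ 2).le_of_opNorm_le (key (-1) (by norm_num)) x
  have e1 : (f c + ((1 * (r / 2) : ℝ) : ℂ) • f c ^ 2) x
      = f c x + ((r / 2 : ℝ) : ℂ) • (f c ^ 2) x := by simp
  have e2 : (f c + ((-1 * (r / 2) : ℝ) : ℂ) • f c ^ 2) x
      = f c x - ((r / 2 : ℝ) : ℂ) • (f c ^ 2) x := by simp [sub_eq_add_neg]
  rw [e1] at h1
  rw [e2] at h2
  -- With ‖a + b‖ and ‖a - b‖ both at most M‖x‖, the parallelogram law yields ‖a‖² + ‖b‖² ≤ M²‖x‖².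
  -- This is where the Hilbert norm is essential.
  have hpar := parallelogram_law_with_norm ℂ (f c x) (((r / 2 : ℝ) : ℂ) • (f c ^ 2) x)
  have hn : ‖((r / 2 : ℝ) : ℂ) • (f c ^ 2) x‖ = r / 2 * ‖(f c ^ 2) x‖ := by
    rw [norm_smul, Complex.norm_real, Real.norm_of_nonneg (by positivity)]
  rw [hn] at hpar
  have h3 := mul_self_le_mul_self (norm_nonneg _) h1
  have h4 := mul_self_le_mul_self (norm_nonneg _) h2
  nlinarith

end Operators

/-! ### Pseudospectra through test vectors -/

/-- The Hilbert adjoint turns z into its conjugate, and conjugating sequences on both sides, an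
isometric antilinear operation, turns it back. -/
theorem norm_banachAdjoint_sub_apply (A : L2Z →L[ℂ] L2Z) (z : ℂ) (x : L2Z) :
    ‖(banachAdjoint A - z • (1 : L2Z →L[ℂ] L2Z)) x‖ =
      ‖ContinuousLinearMap.adjoint (A - z • (1 : L2Z →L[ℂ] L2Z)) (star x)‖ := by
  have : (banachAdjoint A - z • (1 : L2Z →L[ℂ] L2Z)) x =
      star (ContinuousLinearMap.adjoint (A - z • (1 : L2Z →L[ℂ] L2Z)) (star x)) := by
    rw [← ContinuousLinearMap.star_eq_adjoint, star_sub, star_smul, star_one,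
      ContinuousLinearMap.star_eq_adjoint]
    simp [banachAdjoint_apply, star_sub, star_smul]
  rw [this, norm_star]

theorem mem_pseudospectrum_iff {ε : ℝ} (hε : 0 < ε) (A : L2Z →L[ℂ] L2Z) (z : ℂ) :
    z ∈ pseudospectrum ε A ↔ (∃ x : L2Z, ‖(A - z • (1 : L2Z →L[ℂ] L2Z)) x‖ < ε * ‖x‖) ∨
      ∃ x : L2Z, ‖(banachAdjoint A - z • (1 : L2Z →L[ℂ] L2Z)) x‖ < ε * ‖x‖ := by
  rw [pseudospectrum, Set.mem_ofPred_eq, not_isUnit_or_lt_norm_inverse_iff _ hε]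
  refine or_congr Iff.rfl ⟨?_, ?_⟩
  · rintro ⟨x, hx⟩
    refine ⟨star x, ?_⟩
    rwa [norm_banachAdjoint_sub_apply, star_star, norm_star]
  · rintro ⟨x, hx⟩
    refine ⟨star x, ?_⟩
    rwa [← norm_banachAdjoint_sub_apply, norm_star]

theorem mem_pseudospectrumCols_iff (ε : ℝ) (B : L2Z →L[ℂ] L2Z) {S : Set ℤ} (hS : S.Nonempty)
    (z : ℂ) : z ∈ pseudospectrumCols ε B S ↔
      ∃ x ∈ l2On S, ‖(B - z • (1 : L2Z →L[ℂ] L2Z)) x‖ < ε * ‖x‖ := by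
  set T := B - z • (1 : L2Z →L[ℂ] L2Z) with hT
  have hbdd : BddBelow {r : ℝ | ∃ x : l2On S, ‖x‖ = 1 ∧ r = ‖restrictCols T S x‖} :=
    ⟨0, by rintro _ ⟨x, -, rfl⟩; exact norm_nonneg _⟩
  -- Needed because `sInf ∅ = 0` would otherwise count as a small lower norm.
  have hne : {r : ℝ | ∃ x : l2On S, ‖x‖ = 1 ∧ r = ‖restrictCols T S x‖}.Nonempty := by
    obtain ⟨i, hi⟩ := hS
    refine ⟨_, ⟨lp.single 2 i (1 : ℂ), fun j hj => ?_⟩, ?_, rfl⟩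
    · exact lp.single_apply_ne (E := fun _ : ℤ => ℂ) 2 i 1 fun h => hj (by rwa [h])
    · rw [Submodule.coe_norm, lp.norm_single (by norm_num), norm_one]
  rw [pseudospectrumCols, Set.mem_ofPred_eq, lowerNorm, csInf_lt_iff hbdd hne]
  constructor
  · rintro ⟨_, ⟨x, hx, rfl⟩, h⟩
    refine ⟨x, x.2, ?_⟩
    rw [← Submodule.coe_norm, hx, mul_one]
    exact h
  · rintro ⟨x, hxS, hx⟩
    have hx0 : 0 < ‖x‖ := norm_pos_iff.2 fun h => by simp [h] at hx
    refine ⟨_, ⟨((‖x‖⁻¹ : ℝ) : ℂ) • ⟨x, hxS⟩, ?_, rfl⟩, ?_⟩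
    · rw [norm_smul, Complex.norm_real, norm_inv, norm_norm]
      exact inv_mul_cancel₀ hx0.ne'
    · rw [map_smul, norm_smul, Complex.norm_real, norm_inv, norm_norm, inv_mul_eq_div,
        div_lt_iff₀ hx0]
      exact hx

/-! ### Windows and inclusion sets -/

theorem window_nonempty {s n : ℕ} (hs : 0 < s) (hn : 0 < n) (k : ℤ) : (window s n k).Nonempty := by
  refine ⟨s * (k + 1), ?_⟩
  rw [window, Set.mem_ofPred_eq, Int.mul_ediv_cancel_left _ (by exact_mod_cast hs.ne')]
  omega

theorem mem_inclusionSet_iff {s n : ℕ} (hs : 0 < s) (hn : 0 < n) (ε : ℝ) (A : L2Z →L[ℂ] L2Z)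
    (z : ℂ) : z ∈ inclusionSet s n ε A ↔
      ∃ k : ℤ, (∃ x ∈ l2On (window s n k), ‖(A - z • (1 : L2Z →L[ℂ] L2Z)) x‖ < ε * ‖x‖) ∨
        ∃ x ∈ l2On (window s n k), ‖(banachAdjoint A - z • (1 : L2Z →L[ℂ] L2Z)) x‖ < ε * ‖x‖ := by
  simp only [inclusionSet, Set.mem_iUnion, Set.mem_union,
    mem_pseudospectrumCols_iff _ _ (window_nonempty hs hn _)]

theorem inclusionSet_subset_pseudospectrum {s n : ℕ} (hs : 0 < s) (hn : 0 < n) {ε : ℝ}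
    (hε : 0 < ε) (A : L2Z →L[ℂ] L2Z) : inclusionSet s n ε A ⊆ pseudospectrum ε A := by
  intro z hz
  rw [mem_inclusionSet_iff hs hn] at hz
  rw [mem_pseudospectrum_iff hε]
  obtain ⟨k, ⟨x, -, hx⟩ | ⟨x, -, hx⟩⟩ := hz
  · exact Or.inl ⟨x, hx⟩
  · exact Or.inr ⟨x, hx⟩

theorem inclusionSet_mono {s n : ℕ} (hs : 0 < s) (hn : 0 < n) {ε ε' : ℝ} (h : ε ≤ ε')
    (A : L2Z →L[ℂ] L2Z) : inclusionSet s n ε A ⊆ inclusionSet s n ε' A := by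
  intro z hz
  rw [mem_inclusionSet_iff hs hn] at hz ⊢
  obtain ⟨k, ⟨x, hxS, hx⟩ | ⟨x, hxS, hx⟩⟩ := hz
  · exact ⟨k, Or.inl ⟨x, hxS, hx.trans_le (by gcongr)⟩⟩
  · exact ⟨k, Or.inr ⟨x, hxS, hx.trans_le (by gcongr)⟩⟩

theorem exists_subset_window {s : ℕ} (hs : 0 < s) (F : Finset ℤ) :
    ∃ k : ℤ, ∀ᶠ n : ℕ in atTop, (F : Set ℤ) ⊆ window s n k := by
  obtain ⟨a, ha⟩ := F.bddBelow
  obtain ⟨b, hb⟩ := F.bddAbove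
  have hs' : (0 : ℤ) < s := by exact_mod_cast hs
  -- The left end is fixed at the block of a lower bound of F, so increasing n only extends the
  -- window to the right.
  refine ⟨a / s - 1, ?_⟩
  filter_upwards [eventually_ge_atTop (b / s - (a / s - 1)).toNat] with n hn i hi
  have h1 := Int.ediv_le_ediv hs' (ha hi)
  have h2 := Int.ediv_le_ediv hs' (hb hi)
  rw [window, Set.mem_ofPred_eq]
  omega

/-- Finite truncations of x converge to x in norm, and the strict inequality is an open condition.
-/
theorem exists_finite_support_norm_lt {T : L2Z →L[ℂ] L2Z} {ε : ℝ} {x : L2Z}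
    (hx : ‖T x‖ < ε * ‖x‖) : ∃ F : Finset ℤ, ∃ y ∈ l2On (F : Set ℤ), ‖T y‖ < ε * ‖y‖ := by
  have hlim : Tendsto (fun F : Finset ℤ => ∑ i ∈ F, lp.single (E := fun _ : ℤ => ℂ) 2 i (x i))
      atTop (𝓝 x) := lp.hasSum_single (by norm_num) x
  have h1 := ((T.continuous.norm.tendsto x).comp hlim).eventually_lt
    (((continuous_norm.tendsto x).comp hlim).const_mul ε) hx
  obtain ⟨F, hF⟩ := h1.exists
  refine ⟨F, _, Submodule.sum_mem _ fun i hi j hj => ?_, hF⟩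
  exact lp.single_apply_ne (E := fun _ : ℤ => ℂ) 2 i (x i) fun h => hj (by rwa [h])

theorem l2On_mono {S S' : Set ℤ} (h : S ⊆ S') : l2On S ≤ l2On S' :=
  fun _ hx i hi => hx i fun hS => hi (h hS)

theorem eventually_mem_inclusionSet {s : ℕ} (hs : 0 < s) {ε : ℝ} (hε : 0 < ε)
    {A : L2Z →L[ℂ] L2Z} {z : ℂ} (hz : z ∈ pseudospectrum ε A) :
    ∀ᶠ n : ℕ in atTop, z ∈ inclusionSet s n ε A := by
  rcases (mem_pseudospectrum_iff hε A z).1 hz with ⟨x, hx⟩ | ⟨x, hx⟩ <;>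
    obtain ⟨F, y, hyF, hy⟩ := exists_finite_support_norm_lt hx <;>
    obtain ⟨k, hk⟩ := exists_subset_window hs F <;>
    filter_upwards [hk, eventually_gt_atTop 0] with n hn hn0 <;>
    rw [mem_inclusionSet_iff hs hn0]
  · exact ⟨k, Or.inl ⟨y, l2On_mono hn hyF, hy⟩⟩
  · exact ⟨k, Or.inr ⟨y, l2On_mono hn hyF, hy⟩⟩

theorem norm_le_of_mem_pseudospectrum {ε : ℝ} (hε : 0 < ε) {A : L2Z →L[ℂ] L2Z} {z : ℂ}
    (hz : z ∈ pseudospectrum ε A) : ‖z‖ ≤ ‖A‖ + ε := by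
  -- The conjugate of z covers test vectors for the adjoint of A - z.
  have key : ∀ (B : L2Z →L[ℂ] L2Z), ‖B‖ ≤ ‖A‖ → ∀ x : L2Z,
      ‖(B - star z • (1 : L2Z →L[ℂ] L2Z)) x‖ < ε * ‖x‖ ∨
        ‖(B - z • (1 : L2Z →L[ℂ] L2Z)) x‖ < ε * ‖x‖ → ‖z‖ ≤ ‖A‖ + ε := by
    intro B hB x hx
    have hx0 : 0 < ‖x‖ := norm_pos_iff.2 fun h => by simp [h] at hx
    have hgen : ∀ w : ℂ, ‖w‖ = ‖z‖ → ‖(B - w • (1 : L2Z →L[ℂ] L2Z)) x‖ < ε * ‖x‖ →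
        ‖z‖ ≤ ‖A‖ + ε := by
      intro w hw h
      have h1 : ‖w • x‖ ≤ ‖B x‖ + ‖(B - w • (1 : L2Z →L[ℂ] L2Z)) x‖ := by
        have : w • x = B x - (B - w • (1 : L2Z →L[ℂ] L2Z)) x := by simp
        rw [this]
        exact norm_sub_le _ _
      have h2 := B.le_of_opNorm_le hB x
      rw [norm_smul, hw] at h1
      refine le_of_mul_le_mul_right ?_ hx0
      linarith
    rcases hx with hx | hx
    · exact hgen _ (norm_star z) hx
    · exact hgen z rfl hx
  rcases (not_isUnit_or_lt_norm_inverse_iff _ hε).1 hz with ⟨x, hx⟩ | ⟨x, hx⟩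
  · exact key A le_rfl x (Or.inr hx)
  · refine key (star A) (norm_star A).le x (Or.inl ?_)
    rwa [← ContinuousLinearMap.star_eq_adjoint, star_sub, star_smul, star_one] at hx

/-! ### Semicontinuity in the parameter -/

/-- `ε' ↦ spec_{ε'} A` is upper semicontinuous in the Hausdorff sense, even with the open
pseudospectrum at `ε`. -/
theorem eventually_exists_mem_pseudospectrum_dist_lt (A : L2Z →L[ℂ] L2Z) {ε δ : ℝ} (hε : 0 < ε)
    (hδ : 0 < δ) : ∀ᶠ ε' in 𝓝 ε, ∀ z ∈ pseudospectrum ε' A, ∃ y ∈ pseudospectrum ε A,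
      dist z y < δ := by
  -- K bounds ‖A - z‖ for z in any spec_t with t < ε + 1.
  set K : ℝ := ‖A‖ + (‖A‖ + (ε + 1)) with hK
  have hK0 : 0 < K := by positivity
  -- q is the guaranteed drop of the squared resolvent norm below 1/ε²: the estimate is used with r
  -- = δ/2, and ‖x‖ ≤ K²‖T⁻²x‖.
  set q : ℝ := (δ / 2 / 2) ^ 2 / K ^ 4 with hq
  have hq0 : 0 < q := by positivity
  have hcont : ContinuousAt (fun t : ℝ => (1 / t) ^ 2) ε :=
    (continuousAt_const.div continuousAt_id hε.ne').pow 2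
  have h1 : ∀ᶠ t : ℝ in 𝓝 ε, (1 / ε) ^ 2 - q < (1 / t) ^ 2 :=
    hcont.eventually (lt_mem_nhds (by linarith))
  filter_upwards [h1, lt_mem_nhds hε, gt_mem_nhds (lt_add_one ε)] with t ht ht0 ht1 z hz
  by_contra! hfar
  -- If z is δ-far from spec_ε, the resolvent is bounded by 1/ε on the whole δ-disc; the drop at its
  -- centre then excludes z from spec_t.
  have hball : ∀ w ∈ Metric.ball z (2 * (δ / 2)), IsUnit (A - w • (1 : L2Z →L[ℂ] L2Z)) ∧
      ‖Ring.inverse (A - w • (1 : L2Z →L[ℂ] L2Z))‖ ≤ 1 / ε := by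
    intro w hw
    have hw' : w ∉ pseudospectrum ε A := fun h => by
      have := hfar w h
      rw [Metric.mem_ball'] at hw
      linarith
    simpa [pseudospectrum] using hw'
  have hu := (hball z (Metric.mem_ball_self (by linarith))).1
  set T := A - z • (1 : L2Z →L[ℂ] L2Z) with hT
  have hTK : ‖T‖ ≤ K := by
    have hz1 := norm_le_of_mem_pseudospectrum ht0 hz
    calc ‖T‖ ≤ ‖A‖ + ‖z • (1 : L2Z →L[ℂ] L2Z)‖ := norm_sub_le _ _
      _ ≤ ‖A‖ + ‖z‖ * 1 := by
        rw [norm_smul]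
        gcongr
        exact ContinuousLinearMap.norm_id_le
      _ ≤ K := by rw [hK]; linarith
  refine absurd hz ?_
  have : ‖Ring.inverse T‖ ≤ 1 / t := by
    refine ContinuousLinearMap.opNorm_le_bound _ (by positivity) fun x => ?_
    have hmain := norm_inverse_sq_le_of_forall_ball A (half_pos hδ) hball x
    rw [← hT] at hmain
    have hsq : (Ring.inverse T ^ 2) x = Ring.inverse T (Ring.inverse T x) := by simp [sq]
    have hx : ‖x‖ ≤ K ^ 2 * ‖(Ring.inverse T ^ 2) x‖ := by
      rw [hsq]
      calc ‖x‖ = ‖T (T (Ring.inverse T (Ring.inverse T x)))‖ := by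
            rw [apply_inverse_apply hu, apply_inverse_apply hu]
        _ ≤ K * (K * ‖Ring.inverse T (Ring.inverse T x)‖) :=
            (T.le_of_opNorm_le hTK _).trans (by gcongr; exact T.le_of_opNorm_le hTK _)
        _ = _ := by ring
    have hx2 : q * ‖x‖ ^ 2 ≤ (δ / 2 / 2) ^ 2 * ‖(Ring.inverse T ^ 2) x‖ ^ 2 := by
      calc q * ‖x‖ ^ 2 ≤ q * (K ^ 2 * ‖(Ring.inverse T ^ 2) x‖) ^ 2 := by gcongr
        _ = _ := by rw [hq]; field_simp
    refine (sq_le_sq₀ (norm_nonneg _) (by positivity)).1 ?_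
    rw [mul_pow]
    nlinarith [sq_nonneg ‖x‖]
  rw [pseudospectrum, Set.mem_ofPred_eq, not_or, not_not, not_lt]
  exact ⟨hu, this⟩

/-! ### Hausdorff convergence -/

/-- A finite δ-net chosen inside spec_ε reduces uniformity to finitely many pointwise statements. -/
theorem eventually_forall_exists_mem_inclusionSet_dist_lt {s : ℕ} (hs : 0 < s)
    (A : L2Z →L[ℂ] L2Z) {ε δ : ℝ} (hε : 0 < ε) (hδ : 0 < δ) :
    ∀ᶠ n : ℕ in atTop, ∀ z ∈ pseudospectrum ε A, ∃ y ∈ inclusionSet s n ε A, dist z y < δ := by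
  have htb : TotallyBounded (pseudospectrum ε A) :=
    (isCompact_closedBall (0 : ℂ) (‖A‖ + ε)).totallyBounded.subset fun z hz => by
      simpa using norm_le_of_mem_pseudospectrum hε hz
  obtain ⟨t, htsub, htfin, hcover⟩ := Metric.finite_approx_of_totallyBounded htb δ hδ
  filter_upwards [(htfin.eventually_all).2 fun y hy =>
    eventually_mem_inclusionSet hs hε (htsub hy)] with n hn z hz
  obtain ⟨y, hy, hzy⟩ := Set.mem_iUnion₂.1 (hcover hz)
  exact ⟨y, hn y hy, hzy⟩

theorem epsSeq_nonneg (d : ℕ) (A : L2Z →L[ℂ] L2Z) (n : ℕ) : 0 ≤ epsSeq d A n := by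
  refine mul_nonneg (mul_nonneg zero_le_two (add_nonneg ?_ ?_)) (Real.sin_nonneg_of_nonneg_of_le_pi
    (by positivity) (div_le_self Real.pi_pos.le (by linarith [n.cast_nonneg (α := ℝ)]))) <;>
  exact Real.iSup_nonneg fun _ => norm_nonneg _

theorem tendsto_epsSeq (d : ℕ) (A : L2Z →L[ℂ] L2Z) : Tendsto (epsSeq d A) atTop (𝓝 0) := by
  have h : Tendsto (fun n : ℕ => Real.pi / (2 * ((n : ℝ) + 1))) atTop (𝓝 0) :=
    Tendsto.const_div_atTop ((tendsto_natCast_atTop_atTop.atTop_add tendsto_const_nhds).const_mul_atTop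
      two_pos) _
  simpa [epsSeq] using! ((Real.continuous_sin.tendsto 0).comp (by simpa using! h)).const_mul
    (2 * ((⨆ m : ℤ, blockNorm d A (m + 1) m) + ⨆ m : ℤ, blockNorm d A (m - 1) m))

/-- Sandwich: the inclusion set lies in spec_{ε+η_n}, which is close to spec_ε by semicontinuity,
and contains the inclusion set for ε, which is δ-dense in spec_ε. Both limits are instances, with η
= 0 and η = `epsSeq d A`. -/
theorem tendsto_hausdorffEDist_inclusionSet {s : ℕ} (hs : 0 < s) (A : L2Z →L[ℂ] L2Z) {ε : ℝ}
    (hε : 0 < ε) {η : ℕ → ℝ} (hη : ∀ n, 0 ≤ η n) (hη0 : Tendsto η atTop (𝓝 0)) :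
    Tendsto (fun n : ℕ => Metric.hausdorffEDist (inclusionSet s n (ε + η n) A)
      (pseudospectrum ε A)) atTop (𝓝 0) := by
  rw [ENNReal.tendsto_nhds_zero]
  intro r hr
  obtain ⟨δ, hδ, hδr⟩ : ∃ δ : ℝ, 0 < δ ∧ ENNReal.ofReal δ ≤ r := by
    obtain ⟨δ, -, hδ, hδr⟩ := ENNReal.lt_iff_exists_real_btwn.1 hr
    exact ⟨δ, ENNReal.ofReal_pos.1 hδ, hδr.le⟩
  have hlim : Tendsto (fun n => ε + η n) atTop (𝓝 ε) := by simpa using hη0.const_add ε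
  filter_upwards [hlim.eventually (eventually_exists_mem_pseudospectrum_dist_lt A hε hδ),
    eventually_forall_exists_mem_inclusionSet_dist_lt hs A hε hδ, eventually_gt_atTop 0]
    with n h1 h2 hn
  refine (Metric.hausdorffEDist_le_of_mem_edist (fun z hz => ?_) fun z hz => ?_).trans hδr
  · obtain ⟨y, hy, hzy⟩ := h1 z (inclusionSet_subset_pseudospectrum hs hn
      (add_pos_of_pos_of_nonneg hε (hη n)) A hz)
    exact ⟨y, hy, by rw [edist_dist]; exact ENNReal.ofReal_le_ofReal hzy.le⟩
  · obtain ⟨y, hy, hzy⟩ := h2 z hz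
    exact ⟨y, inclusionSet_mono hs hn (le_add_of_nonneg_right (hη n)) A hy,
      by rw [edist_dist]; exact ENNReal.ofReal_le_ofReal hzy.le⟩

theorem proposition2 (A : L2Z →L[ℂ] L2Z) (hA : IsBandOperator A) (d : ℕ) (hd : 0 < d)
    (hAd : IsBlockTridiagonal d A) (s : ℕ) (hs : s = d ∨ s = 1) (ε : ℝ) (hε : 0 < ε) :
    Filter.Tendsto
        (fun n : ℕ => Metric.hausdorffEDist (inclusionSet s n ε A) (pseudospectrum ε A))
        Filter.atTop (nhds 0) ∧
      Filter.Tendsto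
        (fun n : ℕ => Metric.hausdorffEDist (inclusionSet s n (ε + epsSeq d A n) A)
          (pseudospectrum ε A))
        Filter.atTop (nhds 0) := by
  have hs0 : 0 < s := by omega
  refine ⟨?_, tendsto_hausdorffEDist_inclusionSet hs0 A hε (epsSeq_nonneg d A)
    (tendsto_epsSeq d A)⟩
  simpa using tendsto_hausdorffEDist_inclusionSet hs0 A hε (η := fun _ => 0) (fun _ => le_rfl)
    tendsto_const_nhds
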